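/- Let $C=\{u,v,x_1,\dots,x_n\}$ be a cell with two internal sites $u,v$ and $n$ external sites. Take $M$ copies $C_1,\dots,C_M$ of $C$ and identify external sites of distinct cells, so that every resulting external site belongs to exactly $m\ge 1$ distinct cells. Let $\Lambda$ be the resulting lattice, $\mathcal E$ its set of external sites, $\mathcal J=\{1,\dots,M\}$, and $u_j,v_j$ the internal sites of $C_j$. Assume that $\Lambda$ is connected, where two sites are adjacent if they lie in a common cell. Let $c_{r,\sigma}$ ($r\in\Lambda$, $\sigma=\uparrow,\downarrow$) be the annihilation operators on the fermionic Fock space of electrons on $\Lambda$, and put $n_{r,\sigma}=c^\dagger_{r,\sigma}c_{r,\sigma}$. For $\nu>0$ let $$b_{j,\sigma}=c_{u_j,\sigma}+c_{v_j,\sigma}+\nu\sum_{x\in C_j\cap\mathcal E}c_{x,\sigma},\qquad d_{j,\sigma}=c_{u_j,\sigma}-c_{v_j,\sigma},$$ $$H=t\sum_{j=1}^M\sum_{\sigma}b^\dagger_{j,\sigma}b_{j,\sigma}+s'\sum_{j=1}^M\sum_\sigma d^\dagger_{j,\sigma}d_{j,\sigma}+U\sum_{r\in\Lambda}n_{r,\uparrow}n_{r,\downarrow}.$$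 Let $t>0$, $s'=0$ and let the electron number be $N_{\rm e}=|\mathcal E|+|\mathcal J|$, which equals $(n+m)|\Lambda|/(2m+n)$. Then for every $U>0$ the ground states of $H$ with $N_{\rm e}$ electrons have total spin $S_{\rm tot}=S_{\max}=N_{\rm e}/2$, that is, $\hat{\mathbf S}_{\rm tot}^2\Phi=S_{\max}(S_{\max}+1)\Phi$, and they are unique apart from the trivial $(2S_{\max}+1)$-fold degeneracy, that is, the ground states together with $0$ form a space of dimension exactly $2S_{\max}+1=N_{\rm e}+1$. Moreover, no $d$-state is doubly occupied in a ground state: $d_{j,\uparrow}d_{j,\downarrow}\Phi=0$ for every ground state $\Phi$ and every $j\in\mathcal J$. -/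

import Mathlib

open scoped Matrix

noncomputable section

namespace CellHubbard

/-! ### Fermionic Fock space over a finite set of one-particle modes -/

section Fock

variable {α : Type*} [Fintype α] [DecidableEq α]

/-- States of the Fock space over the modes `α`, as coefficient vectors in the orthonormal
occupation-number basis `|T⟩`, where `T : Finset α` is the set of occupied modes.
The basis vector `|∅⟩` is the vacuum. -/
abbrev FockState (α : Type*) := Finset α → ℂ

/-- Operators on the Fock space, as matrices in the occupation-number basis.
The adjoint is the conjugate transpose `ᴴ`. -/
abbrev FockOp (α : Type*) := Matrix (Finset α) (Finset α) ℂ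

/-- The sign of removing the mode `p` from the occupied set `T`: it is `(-1)` to the number of
occupied modes that precede `p` in a fixed numbering of the modes. -/
def fermiSign (p : α) (T : Finset α) : ℂ :=
  (-1) ^ (T.filter fun q => Fintype.equivFin α q < Fintype.equivFin α p).card

/-- The annihilation operator of the mode `p`: it maps `|T⟩` to `± |T \ {p}⟩` if `p ∈ T`, and
to `0` otherwise. The creation operator of `p` is its adjoint `(annihilate p)ᴴ`. -/
def annihilate (p : α) : FockOp α :=
  Matrix.of fun S T => if p ∈ T ∧ S = T.erase p then fermiSign p T else 0

/-- The total particle number operator. -/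
def totalNumber (α : Type*) [Fintype α] [DecidableEq α] : FockOp α :=
  ∑ p : α, (annihilate p)ᴴ * annihilate p

/-- The space of `N`-particle states `Φ` with `H Φ = E Φ` (including `Φ = 0`). -/
def energyEigenspace (H : FockOp α) (N : ℕ) (E : ℝ) : Submodule ℂ (FockState α) :=
  Module.End.eigenspace (Matrix.toLin' H) (E : ℂ) ⊓
    Module.End.eigenspace (Matrix.toLin' (totalNumber α)) (N : ℂ)

/-- The set of the energies of the `N`-particle system with Hamiltonian `H`. Its least element
is the ground state energy. -/
def energies (H : FockOp α) (N : ℕ) : Set ℝ :=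
  {E | energyEigenspace H N E ≠ ⊥}

end Fock

/-! ### The lattice -/

/-- The lattice sites: the internal sites `u j`, `v j` of the `M` cells, and the external sites,
labelled by `E`. -/
inductive Site (M : ℕ) (E : Type*)
  | u (j : Fin M)
  | v (j : Fin M)
  | ext (x : E)
  deriving DecidableEq, Fintype

/-- A gluing of `M` copies of the cell `{u, v, x₁, …, xₙ}`: external sites of `m` distinct cells
are identified with each other, and `E` is the resulting set of external lattice sites. -/
structure CellLattice (n m M : ℕ) (E : Type*) [DecidableEq E] where
  /-- the lattice site that the `i`-th external site of the `j`-th copy becomes -/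
  glue : Fin M → Fin n → E
  /-- external sites of one and the same cell are not identified with each other -/
  glue_injective : ∀ j, Function.Injective (glue j)
  /-- every external lattice site is shared by exactly `m` distinct cells -/
  shared : ∀ x : E, (Finset.univ.filter fun j : Fin M => ∃ i, glue j i = x).card = m

section Model

variable {n m M : ℕ} {E : Type*} [Fintype E] [DecidableEq E]

/-- The `j`-th cell, as a set of lattice sites. -/
def CellLattice.cell (L : CellLattice n m M E) (j : Fin M) : Set (Site M E) :=
  {Site.u j, Site.v j} ∪ Set.range fun i => Site.ext (L.glue j i)

/-- The graph on the lattice sites in which two distinct sites are adjacent if some cell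
contains both. -/
def CellLattice.graph (L : CellLattice n m M E) : SimpleGraph (Site M E) :=
  SimpleGraph.fromRel fun r s => ∃ j, r ∈ L.cell j ∧ s ∈ L.cell j

/-- The spin index: `0` is up, `1` is down. -/
abbrev Spin := Fin 2

/-- One-electron modes: a site and a spin. -/
abbrev Mode (M : ℕ) (E : Type*) := Site M E × Spin

/-- The annihilation operator of an electron at site `r` with spin `σ`. -/
def c (r : Site M E) (σ : Spin) : FockOp (Mode M E) := annihilate (r, σ)

/-- The number operator `c† c` of electrons at site `r` with spin `σ`. -/
def occ (r : Site M E) (σ : Spin) : FockOp (Mode M E) := (c r σ)ᴴ * c r σ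

/-- The Pauli matrices. -/
def pauli : Fin 3 → Matrix Spin Spin ℂ :=
  ![!![0, 1; 1, 0], !![0, -Complex.I; Complex.I, 0], !![1, 0; 0, -1]]

/-- The components of the total spin operator. -/
def totalSpin (M : ℕ) (E : Type*) [Fintype E] [DecidableEq E] (k : Fin 3) :
    FockOp (Mode M E) :=
  (1 / 2 : ℂ) • ∑ r : Site M E, ∑ σ : Spin, ∑ τ : Spin, pauli k σ τ • ((c r σ)ᴴ * c r τ)

/-- The square of the total spin operator. -/
def totalSpinSq (M : ℕ) (E : Type*) [Fintype E] [DecidableEq E] : FockOp (Mode M E) :=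
  ∑ k : Fin 3, totalSpin M E k * totalSpin M E k

/-- `b_{j,σ} = c_{u_j,σ} + c_{v_j,σ} + ν ∑_x c_{x,σ}`, over the `n` external sites `x` of the
`j`-th cell. -/
def CellLattice.b (L : CellLattice n m M E) (ν : ℝ) (j : Fin M) (σ : Spin) :
    FockOp (Mode M E) :=
  c (Site.u j) σ + c (Site.v j) σ + (ν : ℂ) • ∑ i : Fin n, c (Site.ext (L.glue j i)) σ

/-- `d_{j,σ} = c_{u_j,σ} - c_{v_j,σ}`. -/
def d (j : Fin M) (σ : Spin) : FockOp (Mode M E) :=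
  c (Site.u j) σ - c (Site.v j) σ

/-- The Hubbard Hamiltonian
`t ∑_{j,σ} b†_{j,σ} b_{j,σ} + s' ∑_{j,σ} d†_{j,σ} d_{j,σ} + U ∑_r n_{r,↑} n_{r,↓}`. -/
def CellLattice.hamiltonian (L : CellLattice n m M E) (ν t s' U : ℝ) : FockOp (Mode M E) :=
  (t : ℂ) • ∑ j : Fin M, ∑ σ : Spin, (L.b ν j σ)ᴴ * L.b ν j σ
    + (s' : ℂ) • ∑ j : Fin M, ∑ σ : Spin, (d j σ)ᴴ * d j σ
    + (U : ℂ) • ∑ r : Site M E, occ r 0 * occ r 1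

end Model

end CellHubbard

end

/-!
The Hamiltonian is `t ∑ b† b + U ∑ (c_{r,↑} c_{r,↓})† (c_{r,↑} c_{r,↓})`, so its energies are
nonnegative, and the states of energy `0` are those annihilated by all `b_{j,σ}` (all electrons are
in the flat band, `CellLattice.flatStates`) and by all `c_{r,↑} c_{r,↓}` (no site is doubly
occupied). They form `CellLattice.groundSpace`.

The flat band has the basis `v_j - u_j` (one orbital for each cell) and `x - ν ∑_{j ∋ x} u_j` (one
orbital for each external site), which has as many orbitals as there are electrons. Each orbital
has a site `z` of its own, namely `v_j` or `x`. On flat band states every `c_{r,σ}` is a linear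
combination of the operators `c_{z,σ}`; this is `CellLattice.mem_flatStates_iff`. Hence in a ground
state `Φ` no orbital is doubly occupied, and each of them contains exactly one electron. The
condition at `u_j` then says that `Φ` is symmetric under the exchange of the spins of any two
orbitals of the `j`-th cell (`LoweringFamily.singlet_eq_zero`). Exchange symmetry is transitive
(`LoweringFamily.singlet_trans`), so by connectedness it holds for all pairs of orbitals. It is
encoded as the vanishing of `(c_{z,↑} c_{w,↓} - c_{z,↓} c_{w,↑}) Φ`, and by linearity this extends
from the sites `z`, `w` to all sites of the lattice (`CellLattice.ann_ann_exchange`).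

A state without such singlet pairs has maximal spin (`totalSpinSq_mulVec_of_exchange`), and the
statement on the `d`-states is immediate. A symmetric state is determined by its `N + 1` amplitudes
with `0, …, N` down spins (`LoweringFamily.eq_zero_of_amp`), so the dimension of the ground space is
at most `N + 1`. Conversely, the states with all spins in the direction `↑ + ζ ↓`
(`CellLattice.polarized`) are ground states with the amplitudes `1, ζ, …, ζ ^ N`, and `N + 1` of them
are linearly independent by the Vandermonde determinant.
-/

open scoped Matrix

noncomputable section

namespace CellHubbard

/-! ### The canonical anticommutation relations -/

section FockAlgebra

variable {α : Type*} [Fintype α] [DecidableEq α]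

/-- The annihilation operator of the mode `p`, as a linear map. -/
def ann (p : α) : FockState α →ₗ[ℂ] FockState α := (annihilate p).mulVecLin

/-- The creation operator of the mode `p`, as a linear map. -/
def cre (p : α) : FockState α →ₗ[ℂ] FockState α := (annihilate p)ᴴ.mulVecLin

/-- The vacuum state `|∅⟩`. -/
def vacuum (α : Type*) [DecidableEq α] : FockState α := Pi.single ∅ 1

lemma annihilate_mulVec (p : α) (Φ : FockState α) : (annihilate p).mulVec Φ = ann p Φ := rfl

lemma annihilate_conjTranspose_mulVec (p : α) (Φ : FockState α) :
    (annihilate p)ᴴ.mulVec Φ = cre p Φ := rfl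

omit [DecidableEq α] in
lemma fermiSign_mul_self (p : α) (T : Finset α) : fermiSign p T * fermiSign p T = 1 := by
  rw [fermiSign, ← mul_pow]; norm_num

omit [DecidableEq α] in
lemma star_fermiSign (p : α) (T : Finset α) : star (fermiSign p T) = fermiSign p T := by
  simp [fermiSign]

lemma fermiSign_insert {p : α} (q : α) {T : Finset α} (hp : p ∉ T) :
    fermiSign q (insert p T) =
      (if Fintype.equivFin α p < Fintype.equivFin α q then -1 else 1) * fermiSign q T := by
  unfold fermiSign
  rw [Finset.filter_insert]
  split_ifs with h
  · rw [Finset.card_insert_of_notMem (by simp [hp]), pow_succ']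
  · rw [one_mul]

lemma fermiSign_insert_self {p : α} {T : Finset α} (hp : p ∉ T) :
    fermiSign p (insert p T) = fermiSign p T := by
  rw [fermiSign_insert p hp]; simp

lemma ann_apply (p : α) (Φ : FockState α) (T : Finset α) :
    ann p Φ T = if p ∈ T then 0 else fermiSign p T * Φ (insert p T) := by
  simp only [ann, Matrix.mulVecLin_apply, Matrix.mulVec, dotProduct, annihilate, Matrix.of_apply]
  split_ifs with h
  · refine Finset.sum_eq_zero fun S _ => ?_
    rw [if_neg, zero_mul]
    rintro ⟨-, rfl⟩
    simp at h
  · rw [Finset.sum_eq_single (insert p T)]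
    · rw [if_pos (by simp [h]), fermiSign_insert_self h]
    · intro S _ hS
      rw [if_neg, zero_mul]
      rintro ⟨hpS, rfl⟩
      exact hS (Finset.insert_erase hpS).symm
    · simp

lemma cre_apply (p : α) (Φ : FockState α) (T : Finset α) :
    cre p Φ T = if p ∈ T then fermiSign p T * Φ (T.erase p) else 0 := by
  simp only [cre, Matrix.mulVecLin_apply, Matrix.mulVec, dotProduct, annihilate,
    Matrix.conjTranspose_apply, Matrix.of_apply]
  split_ifs with h
  · rw [Finset.sum_eq_single (T.erase p)]
    · rw [if_pos ⟨h, rfl⟩, star_fermiSign]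
    · intro S _ hS
      rw [if_neg (by tauto), star_zero, zero_mul]
    · simp
  · refine Finset.sum_eq_zero fun S _ => ?_
    rw [if_neg (by tauto), star_zero, zero_mul]

omit [DecidableEq α] in
/-- The signs picked up by two distinct modes when their order is exchanged. -/
lemma order_sign {p q : α} (h : p ≠ q) :
    (if Fintype.equivFin α p < Fintype.equivFin α q then (-1 : ℂ) else 1) =
      -(if Fintype.equivFin α q < Fintype.equivFin α p then (-1 : ℂ) else 1) := by
  have h' : Fintype.equivFin α p ≠ Fintype.equivFin α q := by simpa using h
  rcases lt_or_gt_of_ne h' with h1 | h1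
  · rw [if_pos h1, if_neg h1.asymm]
  · rw [if_neg h1.asymm, if_pos h1, neg_neg]

/-- `c_p c_q = - c_q c_p`. -/
lemma ann_ann (p q : α) (Φ : FockState α) : ann p (ann q Φ) = -ann q (ann p Φ) := by
  ext T
  simp only [ann_apply, Pi.neg_apply, Finset.mem_insert]
  by_cases hpq : p = q
  · subst hpq; simp
  by_cases hp : p ∈ T
  · simp [hp]
  by_cases hq : q ∈ T
  · simp [hq]
  rw [if_neg hp, if_neg hq, if_neg (by tauto), if_neg (by tauto), fermiSign_insert q hp,
    fermiSign_insert p hq, order_sign hpq, Finset.insert_comm]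
  ring

lemma ann_ann_self (p : α) (Φ : FockState α) : ann p (ann p Φ) = 0 :=
  self_eq_neg.mp (ann_ann p p Φ)

/-- `c_p c_q† + c_q† c_p = δ_{pq}`. -/
lemma ann_cre (p q : α) (Φ : FockState α) :
    ann p (cre q Φ) = (if p = q then Φ else 0) - cre q (ann p Φ) := by
  ext T
  by_cases hpq : p = q
  · subst hpq
    by_cases hp : p ∈ T
    · obtain ⟨S, hS, rfl⟩ : ∃ S, p ∉ S ∧ T = insert p S :=
        ⟨T.erase p, by simp, (Finset.insert_erase hp).symm⟩
      simp [ann_apply, cre_apply, hS, fermiSign_insert_self hS, ← mul_assoc, fermiSign_mul_self]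
    · simp [ann_apply, cre_apply, hp, fermiSign_insert_self hp, ← mul_assoc, fermiSign_mul_self]
  by_cases hp : p ∈ T
  · simp [ann_apply, cre_apply, hp, hpq]
  by_cases hq : q ∈ T
  · obtain ⟨S, hS, rfl⟩ : ∃ S, q ∉ S ∧ T = insert q S :=
      ⟨T.erase q, by simp, (Finset.insert_erase hq).symm⟩
    have hpS : p ∉ S := by simp_all
    have hqp : ¬ q = p := fun h => hpq h.symm
    have h1 : (insert p (insert q S)).erase q = insert p S := by
      rw [Finset.insert_comm, Finset.erase_insert (by simp [hqp, hS])]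
    simp only [ann_apply, cre_apply, if_neg hp, if_neg hpq, Finset.mem_insert_self,
      Finset.mem_insert_of_mem, if_true, h1, Finset.erase_insert hS, if_neg hpS, Pi.sub_apply,
      Pi.zero_apply, fermiSign_insert q hp, fermiSign_insert p hS, fermiSign_insert_self hS,
      order_sign hpq]
    split_ifs <;> ring
  · have hqp : ¬ q = p := fun h => hpq h.symm
    simp [ann_apply, cre_apply, hq, hp, hpq, hqp]

lemma ann_vacuum (p : α) : ann p (vacuum α) = 0 := by
  ext T
  simp [ann_apply, vacuum]

/-- The particle number operator, as a linear map. -/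
def number (α : Type*) [Fintype α] [DecidableEq α] : FockState α →ₗ[ℂ] FockState α :=
  ∑ p : α, cre p ∘ₗ ann p

lemma number_apply (Φ : FockState α) : number α Φ = ∑ p : α, cre p (ann p Φ) := by
  simp [number]

lemma toLin'_totalNumber : Matrix.toLin' (totalNumber α) = number α := by
  ext Φ : 1
  simp only [totalNumber, map_sum, number, Matrix.toLin'_mul]
  rfl

lemma ann_number (p : α) (Φ : FockState α) :
    ann p (number α Φ) = number α (ann p Φ) + ann p Φ := by
  simp only [number_apply, map_sum, ann_cre, ann_ann p, map_neg, Finset.sum_sub_distrib,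
    Finset.sum_neg_distrib]
  simp [add_comm]

lemma cre_cre (p q : α) (Φ : FockState α) : cre p (cre q Φ) = -cre q (cre p Φ) := by
  have h : annihilate q * annihilate p = -(annihilate p * annihilate q) := by
    refine Matrix.toLin'.injective (LinearMap.ext fun Ψ => ?_)
    simp only [Matrix.toLin'_mul, map_neg]
    exact ann_ann q p Ψ
  have h' := congrArg (fun X => Xᴴ.mulVec Φ) h
  change (annihilate p)ᴴ.mulVec ((annihilate q)ᴴ.mulVec Φ) =
    -(annihilate q)ᴴ.mulVec ((annihilate p)ᴴ.mulVec Φ)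
  simpa [Matrix.conjTranspose_mul, ← Matrix.mulVec_mulVec, Matrix.neg_mulVec] using h'

lemma number_cre (p : α) (Φ : FockState α) :
    number α (cre p Φ) = cre p (number α Φ) + cre p Φ := by
  simp only [number_apply, map_sum, ann_cre, cre_cre p, map_sub, Finset.sum_sub_distrib]
  rw [sub_eq_add_neg, ← Finset.sum_neg_distrib, add_comm]
  congr 1
  simp [apply_ite]

lemma number_vacuum : number α (vacuum α) = 0 := by
  simp [number_apply, ann_vacuum]

/-- The `k`-particle subspace. -/
def sector (α : Type*) [Fintype α] [DecidableEq α] (k : ℕ) : Submodule ℂ (FockState α) :=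
  Module.End.eigenspace (number α) (k : ℂ)

lemma mem_sector {k : ℕ} {Φ : FockState α} : Φ ∈ sector α k ↔ number α Φ = (k : ℂ) • Φ :=
  Module.End.mem_eigenspace_iff

lemma ann_mem_sector {k : ℕ} {Φ : FockState α} (h : Φ ∈ sector α (k + 1)) (p : α) :
    ann p Φ ∈ sector α k := by
  rw [mem_sector] at *
  have := ann_number p Φ
  rw [h, map_smul] at this
  rw [eq_sub_of_add_eq this.symm]
  push_cast
  module

lemma eq_zero_of_ann_eq_zero {k : ℕ} {Φ : FockState α} (h : Φ ∈ sector α (k + 1))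
    (h0 : ∀ p, ann p Φ = 0) : Φ = 0 := by
  rw [mem_sector, number_apply] at h
  simp only [h0, map_zero, Finset.sum_const_zero] at h
  exact (smul_eq_zero.mp h.symm).resolve_left (by exact_mod_cast k.succ_ne_zero)

/-- A state without particles is a multiple of the vacuum. -/
lemma eq_smul_vacuum {Φ : FockState α} (h : Φ ∈ sector α 0) : Φ = Φ ∅ • vacuum α := by
  have key : ∀ T : Finset α, number α Φ T = (T.card : ℂ) * Φ T := by
    intro T
    have hp : ∀ p, cre p (ann p Φ) T = if p ∈ T then Φ T else 0 := by
      intro p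
      rw [cre_apply]
      split_ifs with hp
      · obtain ⟨S, hS, rfl⟩ : ∃ S, p ∉ S ∧ T = insert p S :=
          ⟨T.erase p, by simp, (Finset.insert_erase hp).symm⟩
        simp [ann_apply, hS, fermiSign_insert_self hS, ← mul_assoc, fermiSign_mul_self]
      · rfl
    simp [number_apply, hp]
  rw [mem_sector] at h
  ext T
  have hT := key T
  rw [h] at hT
  by_cases hT0 : T = ∅
  · subst hT0; simp [vacuum]
  · have : (T.card : ℂ) ≠ 0 := by simpa using hT0
    have h0 : Φ T = 0 := by simpa [this, eq_comm, hT0] using hT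
    simp [vacuum, h0, hT0]

end FockAlgebra

/-! ### Anticommuting lowering operators with one orbital per electron -/

/-- Anticommuting operators `A z σ` that annihilate an electron of spin `σ` in the orbital `z`,
acting between the spaces `W k` of `k`-electron states, such that no state with at least one
electron is annihilated by all of them. -/
structure LoweringFamily (κ V : Type*) [AddCommGroup V] [Module ℂ V] where
  /-- annihilation of an electron of spin `σ` in the orbital `z` -/
  A : κ → Fin 2 → V →ₗ[ℂ] V
  /-- the `k`-electron states -/
  W : ℕ → Submodule ℂ V
  anticomm : ∀ z σ w τ Ψ, A z σ (A w τ Ψ) = -A w τ (A z σ Ψ)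
  lower : ∀ k z σ Ψ, Ψ ∈ W (k + 1) → A z σ Ψ ∈ W k
  eq_zero : ∀ k Ψ, Ψ ∈ W (k + 1) → (∀ z σ, A z σ Ψ = 0) → Ψ = 0

namespace LoweringFamily

variable {κ V : Type*} [AddCommGroup V] [Module ℂ V] (F : LoweringFamily κ V)

/-- No orbital is doubly occupied in `Ψ`. -/
def NoDouble (Ψ : V) : Prop := ∀ z, F.A z 0 (F.A z 1 Ψ) = 0

/-- All electrons of `Ψ` are in orbitals from `S`. -/
def SuppOn (S : Finset κ) (Ψ : V) : Prop := ∀ z ∉ S, ∀ σ, F.A z σ Ψ = 0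

/-- Annihilation of a spin singlet in the orbitals `z` and `w`. -/
def singlet (z w : κ) : V →ₗ[ℂ] V := F.A z 0 ∘ₗ F.A w 1 - F.A z 1 ∘ₗ F.A w 0

variable {F}

lemma singlet_apply (z w : κ) (Ψ : V) :
    F.singlet z w Ψ = F.A z 0 (F.A w 1 Ψ) - F.A z 1 (F.A w 0 Ψ) := rfl

lemma A_A_self (z : κ) (σ : Fin 2) (Ψ : V) : F.A z σ (F.A z σ Ψ) = 0 := by
  have h := F.anticomm z σ z σ Ψ
  have h2 : (2 : ℂ) • F.A z σ (F.A z σ Ψ) = 0 := by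
    rw [two_smul]; nth_rewrite 1 [h]; simp
  exact (smul_eq_zero.mp h2).resolve_left two_ne_zero

lemma NoDouble.same {Ψ : V} (h : F.NoDouble Ψ) (z : κ) (σ τ : Fin 2) :
    F.A z σ (F.A z τ Ψ) = 0 := by
  fin_cases σ <;> fin_cases τ
  · exact A_A_self z 0 Ψ
  · exact h z
  · exact (F.anticomm z 1 z 0 Ψ).trans (by rw [h z, neg_zero])
  · exact A_A_self z 1 Ψ

lemma A_A_A (z w y : κ) (σ τ ρ : Fin 2) (Ψ : V) :
    F.A z σ (F.A w τ (F.A y ρ Ψ)) = F.A w τ (F.A y ρ (F.A z σ Ψ)) := by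
  rw [F.anticomm z, F.anticomm z σ y, map_neg, neg_neg]

lemma NoDouble.lower {Ψ : V} (h : F.NoDouble Ψ) (w : κ) (τ : Fin 2) :
    F.NoDouble (F.A w τ Ψ) := fun z => by
  rw [← A_A_A, h z, map_zero]

lemma NoDouble.sub {Ψ Ψ' : V} (h : F.NoDouble Ψ) (h' : F.NoDouble Ψ') :
    F.NoDouble (Ψ - Ψ') := fun z => by
  rw [map_sub, map_sub, h z, h' z, sub_zero]

lemma NoDouble.singlet {Ψ : V} (h : F.NoDouble Ψ) (z w : κ) : F.NoDouble (F.singlet z w Ψ) :=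
  ((h.lower w 1).lower z 0).sub ((h.lower w 0).lower z 1)

lemma singlet_comm (z w : κ) (Ψ : V) : F.singlet z w Ψ = F.singlet w z Ψ := by
  rw [singlet_apply, singlet_apply, F.anticomm z, F.anticomm z 1]
  abel

lemma NoDouble.singlet_self {Ψ : V} (h : F.NoDouble Ψ) (z : κ) : F.singlet z z Ψ = 0 := by
  rw [singlet_apply, h.same, h.same, sub_zero]

lemma A_singlet (x z w : κ) (σ : Fin 2) (Ψ : V) :
    F.A x σ (F.singlet z w Ψ) = F.singlet z w (F.A x σ Ψ) := by
  rw [singlet_apply, singlet_apply, map_sub, A_A_A x z w, A_A_A x z w]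

lemma NoDouble.A_singlet_left {Ψ : V} (h : F.NoDouble Ψ) (z w : κ) (σ : Fin 2) :
    F.A z σ (F.singlet z w Ψ) = 0 := by
  rw [singlet_apply, map_sub, (h.lower w 1).same, (h.lower w 0).same, sub_zero]

lemma NoDouble.A_singlet_right {Ψ : V} (h : F.NoDouble Ψ) (z w : κ) (σ : Fin 2) :
    F.A w σ (F.singlet z w Ψ) = 0 := by
  rw [singlet_comm, h.A_singlet_left]

/-- The three ways of taking a singlet out of three orbitals are linearly dependent, since spinors
are two-dimensional. -/
lemma A_singlet_cyclic (x z w : κ) (σ : Fin 2) (Ψ : V) :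
    F.A x σ (F.singlet z w Ψ) = -F.A w σ (F.singlet z x Ψ) - F.A z σ (F.singlet x w Ψ) := by
  simp only [singlet_apply, map_sub]
  rw [A_A_A w z x, A_A_A w z x]
  fin_cases σ <;> simp only [Fin.zero_eta, Fin.mk_one]
  · rw [F.anticomm x 0 z 0, F.anticomm x 0 z 1]
    abel
  · rw [F.anticomm x 1 z 0, F.anticomm x 1 z 1]
    abel

/-- Amplitude with one electron in each orbital of a list, the first `k` of them with spin down
and the others with spin up. -/
def amp (F : LoweringFamily κ V) : List κ → ℕ → V →ₗ[ℂ] V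
  | [], _ => LinearMap.id
  | x :: l, 0 => amp F l 0 ∘ₗ F.A x 0
  | x :: l, k + 1 => amp F l k ∘ₗ F.A x 1

lemma amp_mem (l : List κ) : ∀ {k : ℕ} {Ψ : V}, Ψ ∈ F.W l.length → F.amp l k Ψ ∈ F.W 0 := by
  induction l with
  | nil => intro k Ψ h; exact h
  | cons x l ih =>
    intro k Ψ h
    cases k with
    | zero => exact ih (F.lower _ x 0 Ψ h)
    | succ k => exact ih (F.lower _ x 1 Ψ h)

variable [DecidableEq κ]

lemma SuppOn.lower {S : Finset κ} {Ψ : V} (h : F.SuppOn S Ψ) (hd : F.NoDouble Ψ) (x : κ)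
    (τ : Fin 2) : F.SuppOn (S.erase x) (F.A x τ Ψ) := by
  intro z hz σ
  by_cases hzx : z = x
  · subst hzx; exact hd.same z σ τ
  · have hzS : z ∉ S := fun hzS => hz (Finset.mem_erase.mpr ⟨hzx, hzS⟩)
    rw [F.anticomm, h z hzS, map_zero, neg_zero]

/-- Pigeonhole principle: without double occupancy, there are no more electrons than orbitals. -/
lemma eq_zero_of_card_lt (S : Finset κ) : ∀ {k : ℕ} {Ψ : V}, Ψ ∈ F.W k → F.NoDouble Ψ →
    F.SuppOn S Ψ → S.card < k → Ψ = 0 := by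
  induction S using Finset.strongInduction with
  | H S ih =>
    intro k Ψ hW hd hS hk
    obtain ⟨k, rfl⟩ : ∃ l, k = l + 1 := ⟨k - 1, by omega⟩
    refine F.eq_zero k Ψ hW fun z σ => ?_
    by_cases hz : z ∈ S
    · refine ih (S.erase z) (Finset.erase_ssubset hz) (F.lower k z σ Ψ hW) (hd.lower z σ)
        (hS.lower hd z σ) ?_
      have := Finset.card_erase_add_one hz
      omega
    · exact hS z hz σ

/-- A nonzero state with one electron in each orbital of `S` is detected by an operator (a product
of annihilation operators) that kills every state with an empty orbital in `S`. -/
lemma exists_detector (S : Finset κ) : ∀ {Ψ : V}, Ψ ∈ F.W S.card → F.NoDouble Ψ →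
    F.SuppOn S Ψ → Ψ ≠ 0 → ∃ B : V →ₗ[ℂ] V, B Ψ ≠ 0 ∧
      ∀ Ψ' : V, ∀ x ∈ S, (∀ σ, F.A x σ Ψ' = 0) → B Ψ' = 0 := by
  induction S using Finset.strongInduction with
  | H S ih =>
    intro Ψ hW hd hS h0
    rcases S.eq_empty_or_nonempty with rfl | hne
    · exact ⟨LinearMap.id, h0, by simp⟩
    obtain ⟨x, σ, hx⟩ : ∃ x σ, F.A x σ Ψ ≠ 0 := by
      by_contra! hall
      refine h0 (F.eq_zero (S.card - 1) Ψ ?_ hall)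
      rwa [Nat.sub_add_cancel (Finset.card_pos.mpr hne)]
    have hxS : x ∈ S := by
      by_contra hxS
      exact hx (hS x hxS σ)
    obtain ⟨B, hB, hB'⟩ := ih (S.erase x) (Finset.erase_ssubset hxS)
      (F.lower _ x σ Ψ (by rwa [Finset.card_erase_add_one hxS])) (hd.lower x σ)
      (hS.lower hd x σ) hx
    refine ⟨B ∘ₗ F.A x σ, hB, fun Ψ' y hy hΨ' => ?_⟩
    by_cases hyx : y = x
    · subst hyx; simp [hΨ']
    · refine hB' _ y (Finset.mem_erase.mpr ⟨hyx, hy⟩) fun τ => ?_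
      rw [F.anticomm, hΨ', map_zero, neg_zero]

/-- States with one electron per orbital that contain no singlet are symmetric in the spins, so
they are determined by the amplitudes that differ in the number of down spins. -/
lemma eq_zero_of_amp (l : List κ) : ∀ {Ψ : V}, l.Nodup → Ψ ∈ F.W l.length →
    F.NoDouble Ψ → F.SuppOn l.toFinset Ψ → (∀ z w, F.singlet z w Ψ = 0) →
    (∀ k ≤ l.length, F.amp l k Ψ = 0) → Ψ = 0 := by
  induction l with
  | nil => intro Ψ _ _ _ _ _ h; exact h 0 le_rfl
  | cons x l ih =>
    intro Ψ hl hW hd hS hD h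
    have hx : x ∉ l.toFinset := by simpa using (List.nodup_cons.mp hl).1
    have hS' : ∀ σ, F.SuppOn l.toFinset (F.A x σ Ψ) := fun σ => by
      have := hS.lower hd x σ
      rwa [List.toFinset_cons, Finset.erase_insert hx] at this
    have hD' : ∀ σ z w, F.singlet z w (F.A x σ Ψ) = 0 := fun σ z w => by
      rw [← A_singlet, hD, map_zero]
    -- With the spin at `x` down, all remaining amplitudes are given.
    have h1 : F.A x 1 Ψ = 0 := ih (List.nodup_cons.mp hl).2 (F.lower _ x 1 Ψ hW) (hd.lower x 1)
      (hS' 1) (hD' 1) fun k hk => h (k + 1) (by simpa using hk)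
    -- With the spin at `x` up, those with a down spin vanish by the exchange symmetry.
    have h2 : ∀ w, F.A w 1 (F.A x 0 Ψ) = 0 := fun w => by
      have := hD w x
      rwa [singlet_apply, h1, map_zero, zero_sub, neg_eq_zero] at this
    have h0 : F.A x 0 Ψ = 0 := by
      refine ih (List.nodup_cons.mp hl).2 (F.lower _ x 0 Ψ hW) (hd.lower x 0) (hS' 0) (hD' 0) ?_
      intro k hk
      cases k with
      | zero => exact h 0 (Nat.zero_le _)
      | succ k =>
        cases l with
        | nil => simp at hk
        | cons y l => simp [amp, h2 y]
    refine eq_zero_of_card_lt l.toFinset hW hd (fun z hz σ => ?_)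
      (lt_of_le_of_lt l.toFinset_card_le (Nat.lt_succ_self _))
    by_cases hzx : z = x
    · subst hzx
      fin_cases σ
      · exact h0
      · exact h1
    · exact hS z (by simpa [hzx] using hz) σ

variable [Fintype κ]

lemma singlet_mem {Ψ : V} (hW : Ψ ∈ F.W (Fintype.card κ)) {z w : κ} (hzw : z ≠ w) :
    F.singlet z w Ψ ∈ F.W ((Finset.univ.erase z).erase w).card := by
  have h1 := Finset.card_erase_add_one (Finset.mem_univ z)
  have h2 := Finset.card_erase_add_one
    (Finset.mem_erase.mpr ⟨hzw.symm, Finset.mem_univ w⟩)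
  rw [← Finset.card_univ, ← h1, ← h2] at hW
  exact Submodule.sub_mem _ (F.lower _ _ _ _ (F.lower _ _ _ _ hW))
    (F.lower _ _ _ _ (F.lower _ _ _ _ hW))

lemma NoDouble.suppOn_singlet {Ψ : V} (h : F.NoDouble Ψ) (z w : κ) :
    F.SuppOn ((Finset.univ.erase z).erase w) (F.singlet z w Ψ) := by
  intro x hx σ
  by_cases hxw : x = w
  · subst hxw; exact h.A_singlet_right z x σ
  · have : x = z := by simpa [hxw] using hx
    subst this; exact h.A_singlet_left x w σ

/-- Exchange symmetry of the spins is transitive, if each orbital contains one electron. -/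
lemma singlet_trans {Ψ : V} (hW : Ψ ∈ F.W (Fintype.card κ)) (hd : F.NoDouble Ψ) {z x w : κ}
    (h1 : F.singlet z x Ψ = 0) (h2 : F.singlet x w Ψ = 0) : F.singlet z w Ψ = 0 := by
  by_cases hzw : z = w
  · subst hzw; exact hd.singlet_self z
  by_cases hxz : x = z
  · subst hxz; exact h2
  by_cases hxw : x = w
  · subst hxw; exact h1
  have hx : x ∈ (Finset.univ.erase z).erase w := by simp [hxz, hxw]
  refine eq_zero_of_card_lt (((Finset.univ.erase z).erase w).erase x) (singlet_mem hW hzw)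
    (hd.singlet z w) (fun y hy σ => ?_) (Finset.card_lt_card (Finset.erase_ssubset hx))
  by_cases hyx : y = x
  · subst hyx
    rw [A_singlet_cyclic, h1, h2, map_zero, map_zero, sub_zero, neg_zero]
  · exact hd.suppOn_singlet z w y (fun h => hy (Finset.mem_erase.mpr ⟨hyx, h⟩)) σ

/-- If a superposition of orbitals is not doubly occupied, then the spins of any two orbitals that
enter it can be exchanged. -/
lemma singlet_eq_zero {Ψ : V} (hW : Ψ ∈ F.W (Fintype.card κ)) (hd : F.NoDouble Ψ) (a : κ → ℂ)
    (h : ∑ y, ∑ y', (a y * a y') • F.A y 0 (F.A y' 1 Ψ) = 0) {z w : κ} (hz : a z ≠ 0)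
    (hw : a w ≠ 0) : F.singlet z w Ψ = 0 := by
  by_cases hzw : z = w
  · subst hzw; exact hd.singlet_self z
  by_contra h0
  obtain ⟨B, hB, hB'⟩ := exists_detector _ (singlet_mem hW hzw) (hd.singlet z w)
    (hd.suppOn_singlet z w) h0
  apply hB
  have hl : ∀ y y', y ≠ z → y ≠ w → B (F.A y 0 (F.A y' 1 Ψ)) = 0 := fun y y' h1 h2 =>
    hB' _ y (by simp [h1, h2]) fun σ => (hd.lower y' 1).same y σ 0
  have hr : ∀ y y', y' ≠ z → y' ≠ w → B (F.A y 0 (F.A y' 1 Ψ)) = 0 := fun y y' h1 h2 => by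
    rw [F.anticomm, map_neg, neg_eq_zero]
    exact hB' _ y' (by simp [h1, h2]) fun σ => (hd.lower y 0).same y' σ 1
  have hsum := congrArg B h
  simp only [map_sum, map_smul, map_zero] at hsum
  rw [Fintype.sum_eq_add z w hzw, Fintype.sum_eq_single w, Fintype.sum_eq_single z] at hsum
  · rw [mul_comm (a w), ← smul_add] at hsum
    have := (smul_eq_zero.mp hsum).resolve_left (mul_ne_zero hz hw)
    rw [singlet_apply, F.anticomm z 1, sub_neg_eq_add, map_add]
    exact this
  · intro y' hy'
    by_cases hyw : y' = w
    · subst hyw; rw [hd y', map_zero, smul_zero]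
    · rw [hr w y' hy' hyw, smul_zero]
  · intro y' hy'
    by_cases hyz : y' = z
    · subst hyz; rw [hd y', map_zero, smul_zero]
    · rw [hr z y' hyz hy', smul_zero]
  · rintro y ⟨h1, h2⟩
    exact Finset.sum_eq_zero fun y' _ => by rw [hl y y' h1 h2, smul_zero]

end LoweringFamily

/-! ### The flat band of the cell lattice -/

section FlatBand

variable {n m M : ℕ} {E : Type*} [Fintype E] [DecidableEq E]

/-- The lattice site of a flat band orbital at which no other orbital of the basis has a nonzero
amplitude. The index `inl j` stands for the orbital of the internal sites of the `j`-th cell, with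
the site `v_j`, and `inr x` for the orbital around the external site `x`. -/
def orbitalSite : Fin M ⊕ E → Site M E := Sum.elim Site.v Site.ext

namespace CellLattice

/-- The amplitude of a flat band orbital at a lattice site. The orbitals
`y = inl j` and `y = inr x` are `v_j - u_j` and `x - ν ∑_{j ∋ x} u_j`. -/
def amplitude (L : CellLattice n m M E) (ν : ℝ) : Site M E → Fin M ⊕ E → ℂ
  | .u j, .inl j' => if j = j' then -1 else 0
  | .u j, .inr x => -(ν * (Finset.univ.filter fun i => L.glue j i = x).card)
  | .v j, y => if .inl j = y then 1 else 0
  | .ext x, y => if .inr x = y then 1 else 0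

omit [Fintype E] in
lemma amplitude_orbitalSite (L : CellLattice n m M E) (ν : ℝ) (z y : Fin M ⊕ E) :
    L.amplitude ν (orbitalSite z) y = if z = y then 1 else 0 := by
  cases z <;> rfl

lemma b_mulVec (L : CellLattice n m M E) (ν : ℝ) (j : Fin M) (σ : Spin)
    (Φ : FockState (Mode M E)) : (L.b ν j σ).mulVec Φ =
      ann (.u j, σ) Φ - ∑ y, L.amplitude ν (.u j) y • ann (orbitalSite y, σ) Φ := by
  have h1 : ∑ i : Fin n, ann (Site.ext (M := M) (L.glue j i), σ) Φ =
      ∑ x : E, ((Finset.univ.filter fun i => L.glue j i = x).card : ℂ) •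
        ann (Site.ext (M := M) x, σ) Φ := by
    rw [← Finset.sum_fiberwise (s := Finset.univ) (g := fun i => L.glue j i)]
    refine Finset.sum_congr rfl fun x _ => ?_
    rw [Finset.sum_congr rfl (g := fun _ => ann (Site.ext (M := M) x, σ) Φ)]
    · rw [Finset.sum_const, Nat.cast_smul_eq_nsmul]
    · intro i hi
      rw [(Finset.mem_filter.mp hi).2]
  simp only [CellLattice.b, c, Matrix.add_mulVec, Matrix.smul_mulVec, Matrix.sum_mulVec,
    annihilate_mulVec, h1, Fintype.sum_sum_type, amplitude, orbitalSite, Sum.elim_inl,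
    Sum.elim_inr, ite_smul, neg_smul, one_smul, zero_smul, Finset.sum_ite_eq, Finset.mem_univ,
    if_true, Finset.sum_neg_distrib, mul_smul, ← Finset.smul_sum]
  abel

/-- The states all of whose electrons are in the flat band, that is, the common kernel of the
operators `b_{j,σ}`. -/
def flatStates (L : CellLattice n m M E) (ν : ℝ) : Submodule ℂ (FockState (Mode M E)) :=
  ⨅ (j : Fin M) (σ : Spin), LinearMap.ker (L.b ν j σ).mulVecLin

lemma mem_flatStates {L : CellLattice n m M E} {ν : ℝ} {Φ : FockState (Mode M E)} :
    Φ ∈ L.flatStates ν ↔ ∀ j σ, (L.b ν j σ).mulVec Φ = 0 := by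
  simp [flatStates, Submodule.mem_iInf]

/-- In a flat band state, an annihilation operator acts like its projection to the flat band. -/
lemma mem_flatStates_iff {L : CellLattice n m M E} {ν : ℝ} {Φ : FockState (Mode M E)} :
    Φ ∈ L.flatStates ν ↔
      ∀ r σ, ann (r, σ) Φ = ∑ y, L.amplitude ν r y • ann (orbitalSite y, σ) Φ := by
  simp only [mem_flatStates, b_mulVec, sub_eq_zero]
  refine ⟨fun h r σ => ?_, fun h j σ => h _ σ⟩
  cases r with
  | u j => exact h j σ
  | v j => simp [amplitude, orbitalSite]
  | ext x => simp [amplitude, orbitalSite]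

lemma ann_mem_flatStates {L : CellLattice n m M E} {ν : ℝ} {Φ : FockState (Mode M E)}
    (h : Φ ∈ L.flatStates ν) (p : Mode M E) : ann p Φ ∈ L.flatStates ν := by
  rw [mem_flatStates_iff] at *
  intro r σ
  rw [ann_ann, h, map_sum, ← Finset.sum_neg_distrib]
  refine Finset.sum_congr rfl fun y _ => ?_
  rw [map_smul, ann_ann p, smul_neg, neg_neg]

/-- The annihilation operators of the sites that label the flat band orbitals, on the flat band
states. -/
def flatFamily (L : CellLattice n m M E) (ν : ℝ) :
    LoweringFamily (Fin M ⊕ E) (FockState (Mode M E)) where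
  A z σ := ann (orbitalSite z, σ)
  W k := L.flatStates ν ⊓ sector (Mode M E) k
  anticomm z σ w τ Ψ := ann_ann _ _ Ψ
  lower _ _ _ _ h := ⟨ann_mem_flatStates h.1 _, ann_mem_sector h.2 _⟩
  eq_zero k Ψ h h0 := by
    refine eq_zero_of_ann_eq_zero h.2 fun p => ?_
    obtain ⟨r, σ⟩ := p
    rw [mem_flatStates_iff.mp h.1]
    exact Finset.sum_eq_zero fun y _ => by rw [h0, smul_zero]

/-- The states with `N` electrons, all in the flat band, and without doubly occupied sites. -/
def groundSpace (L : CellLattice n m M E) (ν : ℝ) (N : ℕ) :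
    Submodule ℂ (FockState (Mode M E)) :=
  (L.flatStates ν ⊓ sector (Mode M E) N) ⊓
    ⨅ r : Site M E, LinearMap.ker (ann (r, (0 : Spin)) ∘ₗ ann (r, 1))

variable {L : CellLattice n m M E} {ν : ℝ} {N : ℕ} {Φ : FockState (Mode M E)}

lemma mem_groundSpace : Φ ∈ L.groundSpace ν N ↔
    (Φ ∈ L.flatStates ν ∧ Φ ∈ sector (Mode M E) N) ∧
      ∀ r, ann (r, (0 : Spin)) (ann (r, 1) Φ) = 0 := by
  simp [groundSpace, Submodule.mem_inf, Submodule.mem_iInf]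

lemma noDouble_of_mem_groundSpace (h : Φ ∈ L.groundSpace ν N) :
    (L.flatFamily ν).NoDouble Φ := fun _ => (mem_groundSpace.mp h).2 _

lemma ann_ann_eq_sum (h : Φ ∈ L.flatStates ν) (r s : Site M E) (σ τ : Spin) :
    ann (r, σ) (ann (s, τ) Φ) = ∑ y, ∑ y', (L.amplitude ν r y * L.amplitude ν s y') •
      ann (orbitalSite y, σ) (ann (orbitalSite y', τ) Φ) := by
  rw [mem_flatStates_iff.mp (ann_mem_flatStates h (s, τ))]
  refine Finset.sum_congr rfl fun y _ => ?_
  rw [mem_flatStates_iff.mp h, map_sum, Finset.smul_sum]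
  refine Finset.sum_congr rfl fun y' _ => ?_
  rw [map_smul, smul_smul]

/-- The flat band orbital attached to a site. -/
def siteOrbital : Site M E → Fin M ⊕ E
  | .u j => .inl j
  | .v j => .inl j
  | .ext x => .inr x

omit [Fintype E] in
lemma amplitude_u_ne_zero (hν : 0 < ν) {j : Fin M} {r : Site M E} (hr : r ∈ L.cell j) :
    L.amplitude ν (.u j) (siteOrbital r) ≠ 0 := by
  rcases hr with (rfl | rfl) | ⟨i, rfl⟩
  · simp [siteOrbital, amplitude]
  · simp [siteOrbital, amplitude]
  · have : (Finset.univ.filter fun i' => L.glue j i' = L.glue j i).Nonempty :=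
      ⟨i, by simp⟩
    simp only [siteOrbital, amplitude, neg_ne_zero, mul_ne_zero_iff]
    exact ⟨by exact_mod_cast hν.ne', by exact_mod_cast (Finset.card_pos.mpr this).ne'⟩

/-- The orbitals of one cell overlap at its site `u_j`, which makes the spins of a ground state
symmetric under exchange within a cell. -/
lemma singlet_eq_zero_of_mem_cell (hν : 0 < ν)
    (h : Φ ∈ L.groundSpace ν (Fintype.card (Fin M ⊕ E))) {j : Fin M} {r s : Site M E}
    (hr : r ∈ L.cell j) (hs : s ∈ L.cell j) :
    (L.flatFamily ν).singlet (siteOrbital r) (siteOrbital s) Φ = 0 := by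
  have h' := mem_groundSpace.mp h
  refine LoweringFamily.singlet_eq_zero h'.1 (noDouble_of_mem_groundSpace h)
    (L.amplitude ν (.u j)) ?_ (amplitude_u_ne_zero hν hr) (amplitude_u_ne_zero hν hs)
  exact (ann_ann_eq_sum h'.1.1 _ _ 0 1).symm.trans (h'.2 (.u j))

lemma singlet_siteOrbital_eq_zero (hL : L.graph.Connected) (hν : 0 < ν)
    (h : Φ ∈ L.groundSpace ν (Fintype.card (Fin M ⊕ E))) (r s : Site M E) :
    (L.flatFamily ν).singlet (siteOrbital r) (siteOrbital s) Φ = 0 := by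
  have h' := mem_groundSpace.mp h
  obtain ⟨w⟩ := hL.preconnected r s
  induction w with
  | nil => exact (noDouble_of_mem_groundSpace h).singlet_self _
  | cons hadj _ ih =>
    refine LoweringFamily.singlet_trans h'.1 (noDouble_of_mem_groundSpace h) ?_ ih
    obtain ⟨-, ⟨j, h1, h2⟩ | ⟨j, h1, h2⟩⟩ := hadj
    · exact singlet_eq_zero_of_mem_cell hν h h1 h2
    · exact singlet_eq_zero_of_mem_cell hν h h2 h1

lemma singlet_eq_zero (hL : L.graph.Connected) (hν : 0 < ν)
    (h : Φ ∈ L.groundSpace ν (Fintype.card (Fin M ⊕ E))) (z w : Fin M ⊕ E) :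
    (L.flatFamily ν).singlet z w Φ = 0 := by
  have hz : ∀ z : Fin M ⊕ E, siteOrbital (orbitalSite z) = z := by rintro (_ | _) <;> rfl
  rw [← hz z, ← hz w]
  exact singlet_siteOrbital_eq_zero hL hν h _ _

/-- A ground state contains no singlet pair. -/
lemma ann_ann_exchange (hL : L.graph.Connected) (hν : 0 < ν)
    (h : Φ ∈ L.groundSpace ν (Fintype.card (Fin M ⊕ E))) (r s : Site M E) :
    ann (r, (0 : Spin)) (ann (s, 1) Φ) = ann (r, 1) (ann (s, 0) Φ) := by
  have h' := (mem_groundSpace.mp h).1.1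
  rw [ann_ann_eq_sum h', ann_ann_eq_sum h']
  refine Finset.sum_congr rfl fun y _ => Finset.sum_congr rfl fun y' _ => ?_
  exact congrArg _ (sub_eq_zero.mp (singlet_eq_zero hL hν h y y'))

lemma d_d_mulVec_eq_zero (hL : L.graph.Connected) (hν : 0 < ν)
    (h : Φ ∈ L.groundSpace ν (Fintype.card (Fin M ⊕ E))) (j : Fin M) :
    (d j 0 * d j 1 : FockOp (Mode M E)).mulVec Φ = 0 := by
  have h' := (mem_groundSpace.mp h).2
  simp only [d, c, ← Matrix.mulVec_mulVec, Matrix.sub_mulVec, annihilate_mulVec, map_sub, h',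
    ann_ann_exchange hL hν h (.u j)]
  rw [ann_ann (Site.v j, (0 : Spin))]
  simp

end CellLattice

/-! ### The total spin -/

/-- The operator `∑_r c_{r,σ}† c_{r,τ}`. -/
def spinHop (M : ℕ) (E : Type*) [Fintype E] [DecidableEq E] (σ τ : Spin) :
    FockState (Mode M E) →ₗ[ℂ] FockState (Mode M E) :=
  ∑ r : Site M E, cre (r, σ) ∘ₗ ann (r, τ)

lemma spinHop_apply (σ τ : Spin) (Φ : FockState (Mode M E)) :
    spinHop M E σ τ Φ = ∑ r : Site M E, cre (r, σ) (ann (r, τ) Φ) := by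
  simp [spinHop]

lemma toLin'_totalSpin (k : Fin 3) : Matrix.toLin' (totalSpin M E k) =
    (1 / 2 : ℂ) • ∑ σ, ∑ τ, pauli k σ τ • spinHop M E σ τ := by
  have h : ∀ (r : Site M E) (σ τ : Spin), Matrix.toLin' ((c r σ)ᴴ * c r τ) =
      cre (r, σ) ∘ₗ ann (r, τ) := fun r σ τ => Matrix.toLin'_mul _ _
  simp only [totalSpin, map_smul, map_sum, h, spinHop, Finset.smul_sum]
  rw [Finset.sum_comm]
  refine Finset.sum_congr rfl fun σ _ => ?_
  rw [Finset.sum_comm]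

/-- The Fierz identity for the Pauli matrices, on states. -/
lemma totalSpinSq_mulVec (Φ : FockState (Mode M E)) : (totalSpinSq M E).mulVec Φ =
    (1 / 4 : ℂ) • ((2 : ℂ) • ∑ σ, ∑ τ, spinHop M E σ τ (spinHop M E τ σ Φ)
      - ∑ σ, ∑ τ, spinHop M E σ σ (spinHop M E τ τ Φ)) := by
  rw [← Matrix.toLin'_apply]
  simp only [totalSpinSq, Matrix.toLin'_mul, toLin'_totalSpin, Fin.sum_univ_three,
    Fin.sum_univ_two, pauli, LinearMap.add_apply, LinearMap.comp_apply, LinearMap.smul_apply,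
    map_add, map_smul]
  simp
  match_scalars <;> ring_nf <;> simp <;> norm_num

lemma number_eq_spinHop (Φ : FockState (Mode M E)) :
    number (Mode M E) Φ = spinHop M E 0 0 Φ + spinHop M E 1 1 Φ := by
  rw [number_apply, Fintype.sum_prod_type, spinHop_apply, spinHop_apply,
    ← Finset.sum_add_distrib]
  simp

/-- In a state without singlet pairs, electrons exchange their spins without effect. -/
lemma spinHop_spinHop {Φ : FockState (Mode M E)} {σ τ : Spin} (hστ : σ ≠ τ)
    (h : ∀ r s : Site M E, ann (r, σ) (ann (s, τ) Φ) = ann (r, τ) (ann (s, σ) Φ)) :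
    spinHop M E σ τ (spinHop M E τ σ Φ) =
      spinHop M E σ σ Φ + spinHop M E σ σ (spinHop M E τ τ Φ) := by
  simp only [spinHop_apply, map_sum, ann_cre, map_sub, Finset.sum_sub_distrib]
  have h1 : ∀ r s : Site M E, ((r, σ) : Mode M E) ≠ (s, τ) := by simp [hστ]
  simp only [h1, if_false, map_zero, Prod.mk.injEq, and_true, apply_ite (cre _), h,
    Finset.sum_ite_eq', Finset.mem_univ, if_true, Finset.sum_const_zero, zero_sub]
  rw [sub_eq_add_neg]

lemma totalSpinSq_mulVec_of_exchange {Φ : FockState (Mode M E)} {N : ℕ}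
    (hN : Φ ∈ sector (Mode M E) N)
    (h : ∀ r s : Site M E, ann (r, (0 : Spin)) (ann (s, 1) Φ) = ann (r, 1) (ann (s, 0) Φ)) :
    (totalSpinSq M E).mulVec Φ = (((N : ℂ) / 2) * ((N : ℂ) / 2 + 1)) • Φ := by
  have h01 := spinHop_spinHop zero_ne_one h
  have h10 := spinHop_spinHop one_ne_zero fun r s => (h r s).symm
  rw [mem_sector] at hN
  have h2 : number (Mode M E) (number (Mode M E) Φ) = ((N : ℂ) * N) • Φ := by
    rw [hN, map_smul, hN, smul_smul]
  rw [number_eq_spinHop] at hN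
  simp only [number_eq_spinHop, map_add] at h2
  rw [totalSpinSq_mulVec]
  simp only [Fin.sum_univ_two, h01, h10]
  have : (((N : ℂ) / 2) * ((N : ℂ) / 2 + 1)) • Φ =
      (1 / 4 : ℂ) • ((2 : ℂ) • (N : ℂ) • Φ + ((N : ℂ) * N) • Φ) := by module
  rw [this, ← hN, ← h2]
  module

end FlatBand

section GroundStates

variable {n m M : ℕ} {E : Type*} [Fintype E] [DecidableEq E]

namespace CellLattice

/-! ### Ferromagnetic states -/

/-- Creation of an electron in the flat band orbital `z`, in the spin state `↑ + ζ ↓`. -/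
def createFlat (L : CellLattice n m M E) (ν : ℝ) (ζ : ℂ) (z : Fin M ⊕ E) :
    FockState (Mode M E) →ₗ[ℂ] FockState (Mode M E) :=
  ∑ σ : Spin, ζ ^ (σ : ℕ) • ∑ r : Site M E, L.amplitude ν r z • cre (r, σ)

/-- The state with one electron in the spin state `↑ + ζ ↓` in each of the orbitals of a list. -/
def polarized (L : CellLattice n m M E) (ν : ℝ) (ζ : ℂ) :
    List (Fin M ⊕ E) → FockState (Mode M E)
  | [] => vacuum _
  | z :: l => L.createFlat ν ζ z (polarized L ν ζ l)

variable {L : CellLattice n m M E} {ν : ℝ} {ζ : ℂ}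

lemma createFlat_apply (z : Fin M ⊕ E) (Φ : FockState (Mode M E)) : L.createFlat ν ζ z Φ =
    ∑ σ : Spin, ζ ^ (σ : ℕ) • ∑ r : Site M E, L.amplitude ν r z • cre (r, σ) Φ := by
  simp [createFlat]

lemma ann_createFlat (r : Site M E) (σ : Spin) (z : Fin M ⊕ E) (Φ : FockState (Mode M E)) :
    ann (r, σ) (L.createFlat ν ζ z Φ) =
      (ζ ^ (σ : ℕ) * L.amplitude ν r z) • Φ - L.createFlat ν ζ z (ann (r, σ) Φ) := by
  simp only [createFlat_apply, map_sum, map_smul, ann_cre, smul_sub, Finset.sum_sub_distrib]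
  congr 1
  rw [Finset.sum_eq_single σ, Finset.sum_eq_single r]
  · rw [if_pos rfl, smul_smul]
  · intro s _ hs
    rw [if_neg (by simp [hs.symm]), smul_zero]
  · simp
  · intro τ _ hτ
    rw [Finset.sum_eq_zero, smul_zero]
    intro s _
    rw [if_neg (by simp [hτ.symm]), smul_zero]
  · simp

lemma number_createFlat (z : Fin M ⊕ E) (Φ : FockState (Mode M E)) :
    number (Mode M E) (L.createFlat ν ζ z Φ) =
      L.createFlat ν ζ z (number (Mode M E) Φ) + L.createFlat ν ζ z Φ := by
  simp only [createFlat_apply, map_sum, map_smul, number_cre, smul_add, Finset.sum_add_distrib]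

lemma polarized_mem_sector (l : List (Fin M ⊕ E)) :
    L.polarized ν ζ l ∈ sector (Mode M E) l.length := by
  rw [mem_sector]
  induction l with
  | nil => simp [polarized, number_vacuum]
  | cons z l ih =>
    rw [polarized, number_createFlat, ih, map_smul, List.length_cons]
    push_cast
    module

lemma polarized_mem_flatStates (l : List (Fin M ⊕ E)) :
    L.polarized ν ζ l ∈ L.flatStates ν := by
  rw [mem_flatStates_iff]
  induction l with
  | nil => simp [polarized, ann_vacuum]
  | cons z l ih =>
    intro r σ
    simp only [polarized, ann_createFlat, amplitude_orbitalSite, smul_sub,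
      Finset.sum_sub_distrib, ih r σ, map_sum, map_smul]
    congr 1
    simp [smul_smul, mul_comm]

lemma ann_down_polarized (l : List (Fin M ⊕ E)) (r : Site M E) :
    ann (r, (1 : Spin)) (L.polarized ν ζ l) = ζ • ann (r, (0 : Spin)) (L.polarized ν ζ l) := by
  induction l with
  | nil => simp [polarized, ann_vacuum]
  | cons z l ih =>
    simp only [polarized, ann_createFlat, ih, map_smul]
    simp [smul_sub, smul_smul]

lemma polarized_mem_groundSpace (l : List (Fin M ⊕ E)) :
    L.polarized ν ζ l ∈ L.groundSpace ν l.length := by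
  refine mem_groundSpace.mpr ⟨⟨polarized_mem_flatStates l, polarized_mem_sector l⟩, fun r => ?_⟩
  rw [ann_down_polarized, map_smul, ann_ann_self, smul_zero]

lemma ann_polarized_of_notMem {l : List (Fin M ⊕ E)} {z : Fin M ⊕ E} (hz : z ∉ l) (σ : Spin) :
    ann (orbitalSite z, σ) (L.polarized ν ζ l) = 0 := by
  induction l with
  | nil => exact ann_vacuum _
  | cons w l ih =>
    rw [List.mem_cons, not_or] at hz
    rw [polarized, ann_createFlat, ih hz.2, amplitude_orbitalSite, if_neg hz.1]
    simp

lemma amp_polarized {l : List (Fin M ⊕ E)} (hl : l.Nodup) {k : ℕ} (hk : k ≤ l.length) :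
    (L.flatFamily ν).amp l k (L.polarized ν ζ l) = ζ ^ k • vacuum (Mode M E) := by
  induction l generalizing k with
  | nil => simp_all [LoweringFamily.amp, polarized]
  | cons z l ih =>
    rw [List.nodup_cons] at hl
    have h : ∀ σ, (L.flatFamily ν).A z σ (L.polarized ν ζ (z :: l)) =
        ζ ^ (σ : ℕ) • L.polarized ν ζ l := fun σ => by
      change ann (orbitalSite z, σ) _ = _
      rw [polarized, ann_createFlat, ann_polarized_of_notMem hl.1, amplitude_orbitalSite]
      simp
    cases k with
    | zero =>
      simp only [LoweringFamily.amp, LinearMap.comp_apply, h, map_smul, ih hl.2 (Nat.zero_le _)]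
      simp
    | succ k =>
      simp only [LoweringFamily.amp, LinearMap.comp_apply, h, map_smul,
        ih hl.2 (Nat.le_of_succ_le_succ hk), smul_smul, pow_succ']
      simp

/-! ### The dimension of the ground space -/

/-- The amplitudes of a state for `k = 0, …, N` down spins, with one electron in each of the
orbitals of a list. -/
def spinAmplitudes (L : CellLattice n m M E) (ν : ℝ) (l : List (Fin M ⊕ E)) :
    FockState (Mode M E) →ₗ[ℂ] (Fin (l.length + 1) → ℂ) :=
  LinearMap.pi fun k => LinearMap.proj ∅ ∘ₗ (L.flatFamily ν).amp l k

lemma finrank_groundSpace (hL : L.graph.Connected) (hν : 0 < ν) :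
    Module.finrank ℂ (L.groundSpace ν (Fintype.card (Fin M ⊕ E))) =
      Fintype.card (Fin M ⊕ E) + 1 := by
  obtain ⟨l, hl, hmem⟩ : ∃ l : List (Fin M ⊕ E), l.Nodup ∧ l.toFinset = Finset.univ :=
    ⟨Finset.univ.toList, Finset.nodup_toList _, Finset.toList_toFinset _⟩
  have hcard : Fintype.card (Fin M ⊕ E) = l.length := by
    rw [← List.toFinset_card_of_nodup hl, hmem, Finset.card_univ]
  have hsinglet := fun Φ => singlet_eq_zero (Φ := Φ) hL hν
  rw [hcard] at hsinglet ⊢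
  apply le_antisymm
  · have hinj : Function.Injective
        ((L.spinAmplitudes ν l).domRestrict (L.groundSpace ν l.length)) := by
      rw [← LinearMap.ker_eq_bot, LinearMap.ker_eq_bot']
      rintro ⟨Φ, hΦ⟩ h0
      have hW : Φ ∈ (L.flatFamily ν).W l.length := (mem_groundSpace.mp hΦ).1
      refine Subtype.ext (LoweringFamily.eq_zero_of_amp l hl hW (noDouble_of_mem_groundSpace hΦ)
        (fun z hz => by simp [hmem] at hz) (hsinglet Φ hΦ) fun k hk => ?_)
      have hk0 : (L.flatFamily ν).amp l k Φ ∅ = 0 :=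
        congrFun h0 ⟨k, Nat.lt_succ_of_le hk⟩
      rw [eq_smul_vacuum (LoweringFamily.amp_mem l hW).2, hk0, zero_smul]
    simpa using LinearMap.finrank_le_finrank_of_injective hinj
  · let v : Fin (l.length + 1) → L.groundSpace ν l.length := fun i =>
      ⟨L.polarized ν (i : ℕ) l, polarized_mem_groundSpace l⟩
    have hv : (fun i => L.spinAmplitudes ν l (v i)) =
        (Matrix.vandermonde fun i : Fin (l.length + 1) => ((i : ℕ) : ℂ)).row := by
      funext i k
      have hk := amp_polarized (L := L) (ν := ν) (ζ := (i : ℕ)) hl (Nat.le_of_lt_succ k.2)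
      simp [spinAmplitudes, v, hk, vacuum, Matrix.vandermonde_apply]
    have hli : LinearIndependent ℂ v := by
      refine LinearIndependent.of_comp
        ((L.spinAmplitudes ν l).domRestrict (L.groundSpace ν l.length)) ?_
      change LinearIndependent ℂ (fun i => L.spinAmplitudes ν l (v i))
      rw [hv]
      refine Matrix.linearIndependent_rows_of_det_ne_zero (Matrix.det_vandermonde_ne_zero_iff.mpr ?_)
      exact fun i j hij => Fin.ext (Nat.cast_injective (R := ℂ) hij)
    simpa using hli.fintype_card_le_finrank

/-! ### The Hamiltonian -/

lemma star_dotProduct_self {ι : Type*} [Fintype ι] (v : ι → ℂ) :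
    star v ⬝ᵥ v = ((∑ i, ‖v i‖ ^ 2 : ℝ) : ℂ) := by
  simp only [dotProduct, Pi.star_apply, RCLike.star_def, Complex.conj_mul']
  push_cast
  rfl

lemma sum_norm_sq_eq_zero {ι : Type*} [Fintype ι] {v : ι → ℂ} (h : ∑ i, ‖v i‖ ^ 2 = 0) :
    v = 0 := by
  rw [Finset.sum_eq_zero_iff_of_nonneg fun _ _ => by positivity] at h
  ext i
  simpa using h i (Finset.mem_univ i)

lemma star_dotProduct_conjTranspose_mul_self {ι : Type*} [Fintype ι] (A : Matrix ι ι ℂ)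
    (v : ι → ℂ) : star v ⬝ᵥ (Aᴴ * A).mulVec v = ((∑ i, ‖A.mulVec v i‖ ^ 2 : ℝ) : ℂ) := by
  rw [← star_dotProduct_self, ← Matrix.mulVec_mulVec, Matrix.dotProduct_mulVec, Matrix.star_mulVec]

lemma occ_mul_occ (r : Site M E) : occ r 0 * occ r 1 = (c r 0 * c r 1)ᴴ * (c r 0 * c r 1) := by
  refine Matrix.toLin'.injective (LinearMap.ext fun Φ => ?_)
  simp only [occ, c, Matrix.toLin'_apply, Matrix.conjTranspose_mul, ← Matrix.mulVec_mulVec,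
    annihilate_mulVec, annihilate_conjTranspose_mulVec]
  rw [ann_cre, cre_cre (r, 1)]
  simp

lemma hamiltonian_mulVec (t U : ℝ) (Φ : FockState (Mode M E)) :
    (L.hamiltonian ν t 0 U).mulVec Φ =
      (t : ℂ) • ∑ j, ∑ σ, ((L.b ν j σ)ᴴ * L.b ν j σ).mulVec Φ +
      (U : ℂ) • ∑ r : Site M E, ((c r 0 * c r 1)ᴴ * (c r 0 * c r 1)).mulVec Φ := by
  simp only [hamiltonian, Complex.ofReal_zero, zero_smul, add_zero, Matrix.add_mulVec,
    Matrix.smul_mulVec, Matrix.sum_mulVec, occ_mul_occ]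

/-- The energy is a sum of squares. -/
lemma star_dotProduct_hamiltonian (t U : ℝ) (Φ : FockState (Mode M E)) :
    star Φ ⬝ᵥ (L.hamiltonian ν t 0 U).mulVec Φ =
      ((t * ∑ j, ∑ σ, ∑ T, ‖(L.b ν j σ).mulVec Φ T‖ ^ 2 +
        U * ∑ r : Site M E, ∑ T, ‖(c r 0 * c r 1).mulVec Φ T‖ ^ 2 : ℝ) : ℂ) := by
  simp only [hamiltonian_mulVec, dotProduct_add, dotProduct_smul, dotProduct_sum,
    star_dotProduct_conjTranspose_mul_self, smul_eq_mul]
  push_cast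
  rfl

lemma mem_energyEigenspace {H : FockOp (Mode M E)} {N : ℕ} {e : ℝ} {Φ : FockState (Mode M E)} :
    Φ ∈ energyEigenspace H N e ↔ H.mulVec Φ = (e : ℂ) • Φ ∧ Φ ∈ sector (Mode M E) N := by
  rw [energyEigenspace, Submodule.mem_inf, Module.End.mem_eigenspace_iff, Matrix.toLin'_apply,
    toLin'_totalNumber, sector]

lemma energyEigenspace_zero {t U : ℝ} (ht : 0 < t) (hU : 0 < U) (N : ℕ) :
    energyEigenspace (L.hamiltonian ν t 0 U) N 0 = L.groundSpace ν N := by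
  ext Φ
  have hcc : ∀ r : Site M E,
      (c r 0 * c r 1).mulVec Φ = ann (r, (0 : Spin)) (ann (r, 1) Φ) := fun r =>
    (Matrix.mulVec_mulVec _ _ _).symm
  rw [mem_energyEigenspace, mem_groundSpace, mem_flatStates, Complex.ofReal_zero, zero_smul]
  constructor
  · rintro ⟨h, hN⟩
    have h0 := star_dotProduct_hamiltonian (L := L) (ν := ν) t U Φ
    rw [h, dotProduct_zero, eq_comm, Complex.ofReal_eq_zero] at h0
    have hb : 0 ≤ ∑ j, ∑ σ, ∑ T, ‖(L.b ν j σ).mulVec Φ T‖ ^ 2 := by positivity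
    have hc : 0 ≤ ∑ r : Site M E, ∑ T, ‖(c r 0 * c r 1).mulVec Φ T‖ ^ 2 := by positivity
    have hb0 : ∑ j, ∑ σ, ∑ T, ‖(L.b ν j σ).mulVec Φ T‖ ^ 2 = 0 := by
      nlinarith [mul_nonneg ht.le hb, mul_nonneg hU.le hc]
    have hc0 : ∑ r : Site M E, ∑ T, ‖(c r 0 * c r 1).mulVec Φ T‖ ^ 2 = 0 := by
      nlinarith [mul_nonneg ht.le hb, mul_nonneg hU.le hc]
    rw [Finset.sum_eq_zero_iff_of_nonneg fun _ _ => by positivity] at hb0 hc0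
    refine ⟨⟨fun j σ => ?_, hN⟩, fun r => ?_⟩
    · have := hb0 j (Finset.mem_univ j)
      rw [Finset.sum_eq_zero_iff_of_nonneg fun _ _ => by positivity] at this
      exact sum_norm_sq_eq_zero (this σ (Finset.mem_univ σ))
    · rw [← hcc]
      exact sum_norm_sq_eq_zero (hc0 r (Finset.mem_univ r))
  · rintro ⟨⟨hb, hN⟩, hc⟩
    refine ⟨?_, hN⟩
    simp only [← hcc] at hc
    simp only [hamiltonian_mulVec, ← Matrix.mulVec_mulVec _ (_ᴴ), hb, hc]
    simp

lemma nonneg_of_mem_energies {t U : ℝ} (ht : 0 < t) (hU : 0 < U) {N : ℕ} {e : ℝ}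
    (he : e ∈ energies (L.hamiltonian ν t 0 U) N) : 0 ≤ e := by
  obtain ⟨Φ, hΦ, h0⟩ := (Submodule.ne_bot_iff _).mp he
  obtain ⟨q, hq, h⟩ : ∃ q : ℝ, 0 ≤ q ∧ star Φ ⬝ᵥ (L.hamiltonian ν t 0 U).mulVec Φ = q :=
    ⟨_, by positivity, star_dotProduct_hamiltonian t U Φ⟩
  rw [(mem_energyEigenspace.mp hΦ).1, dotProduct_smul, star_dotProduct_self, smul_eq_mul,
    ← Complex.ofReal_mul, Complex.ofReal_inj] at h
  have hpos : 0 < ∑ T, ‖Φ T‖ ^ 2 :=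
    lt_of_le_of_ne (by positivity) fun h => h0 (sum_norm_sq_eq_zero h.symm)
  exact nonneg_of_mul_nonneg_left (h ▸ hq) hpos

/-! ### The filling factor -/

/-- Double counting of the pairs of a cell and one of its external sites. -/
lemma mul_card_ext (L : CellLattice n m M E) : m * Fintype.card E = n * M := by
  have h := Finset.sum_card_bipartiteAbove_eq_sum_card_bipartiteBelow
    (s := (Finset.univ : Finset E)) (t := (Finset.univ : Finset (Fin M)))
    (fun x j => ∃ i, L.glue j i = x)
  have h2 : ∀ j, (Finset.univ.filter fun x => ∃ i, L.glue j i = x).card = n := fun j => by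
    rw [show (Finset.univ.filter fun x => ∃ i, L.glue j i = x) = Finset.univ.image (L.glue j) by
      ext x; simp, Finset.card_image_of_injective _ (L.glue_injective j), Finset.card_fin]
  simp only [Finset.bipartiteAbove, Finset.bipartiteBelow, L.shared, h2, Finset.sum_const,
    Finset.card_univ, Fintype.card_fin, smul_eq_mul] at h
  linarith

omit [DecidableEq E] in
lemma card_site : Fintype.card (Site M E) = 2 * M + Fintype.card E := by
  let e : Site M E ≃ (Fin M ⊕ Fin M) ⊕ E :=
    { toFun := fun
        | .u j => .inl (.inl j)
        | .v j => .inl (.inr j)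
        | .ext x => .inr x
      invFun := Sum.elim (Sum.elim .u .v) .ext
      left_inv := by rintro (_ | _ | _) <;> rfl
      right_inv := by rintro ((_ | _) | _) <;> rfl }
  rw [Fintype.card_congr e]
  simp
  ring

end CellLattice

end GroundStates

end CellHubbard
end

open CellHubbard CellHubbard.CellLattice in
theorem theorem2 {n m M : ℕ} {E : Type*} [Fintype E] [DecidableEq E] (hm : 1 ≤ m)
    (L : CellHubbard.CellLattice n m M E) (hL : L.graph.Connected)
    (ν t U : ℝ) (hν : 0 < ν) (ht : 0 < t) (hU : 0 < U)
    (Ne : ℕ) (hNe : Ne = Fintype.card E + M) :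
    (Ne : ℝ) = (n + m) * Fintype.card (CellHubbard.Site M E) / (2 * m + n) ∧
    ∃ E₀ : ℝ,
      -- `E₀` is the ground state energy for `Ne` electrons, with `s' = 0`
      IsLeast (CellHubbard.energies (L.hamiltonian ν t 0 U) Ne) E₀ ∧
      -- every ground state has total spin `Ne / 2`
      (∀ Φ ∈ CellHubbard.energyEigenspace (L.hamiltonian ν t 0 U) Ne E₀,
        (CellHubbard.totalSpinSq M E).mulVec Φ =
          (((Ne : ℂ) / 2) * ((Ne : ℂ) / 2 + 1)) • Φ) ∧
      -- the degeneracy is exactly `2 * (Ne / 2) + 1`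
      Module.finrank ℂ (CellHubbard.energyEigenspace (L.hamiltonian ν t 0 U) Ne E₀) = Ne + 1 ∧
      -- no `d`-state is doubly occupied in a ground state
      (∀ Φ ∈ CellHubbard.energyEigenspace (L.hamiltonian ν t 0 U) Ne E₀, ∀ j : Fin M,
        (CellHubbard.d j 0 * CellHubbard.d j 1 : CellHubbard.FockOp (CellHubbard.Mode M E)).mulVec
          Φ = 0) := by
  have hcard : Ne = Fintype.card (Fin M ⊕ E) := by
    rw [hNe, Fintype.card_sum, Fintype.card_fin, add_comm]
  refine ⟨?_, 0, ⟨?_, fun e he => nonneg_of_mem_energies ht hU he⟩, ?_, ?_, ?_⟩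
  · have hm' : (1 : ℝ) ≤ m := by exact_mod_cast hm
    have h : (m : ℝ) * Fintype.card E = n * M := by exact_mod_cast L.mul_card_ext
    rw [eq_div_iff (by positivity), hNe, card_site]
    push_cast
    linear_combination h
  · intro h
    have := finrank_groundSpace hL hν
    rw [← hcard, ← energyEigenspace_zero (L := L) ht hU, h, finrank_bot] at this
    omega
  all_goals rw [energyEigenspace_zero ht hU, hcard]
  · exact fun Φ hΦ => totalSpinSq_mulVec_of_exchange (mem_groundSpace.mp hΦ).1.2
      (ann_ann_exchange hL hν hΦ)
  · exact finrank_groundSpace hL hν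
  · exact fun Φ hΦ j => d_d_mulVec_eq_zero hL hν hΦ j
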